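/- Let $(M,\omega)$ be a compact K\"ahler manifold of complex dimension $n$ and let $E\to M$ be a very ample holomorphic vector bundle of rank $r$, with $N=\dim H^0(M,E)$. (Very ample: the global holomorphic sections generate every fibre of $E$, and the resulting Kodaira map of $M$ to a Grassmannian is an embedding.) For a basis $\underline s=(s_1,\dots,s_N)$ of $H^0(M,E)$ let $i_{\underline s}:M\to G(r,N)$ be the Kodaira map: $i_{\underline s}(x)\subset\mathbb C^N$ is the $r$-dimensional subspace $\{(\xi(s_1(x)),\dots,\xi(s_N(x))):\xi\in E_x^*\}$, which in a local frame $\sigma_1,\dots,\sigma_r$ of $E$ is the column space of the $N\times r$ matrix $(S_{j\alpha}(x))$, where $s_j=\sum_\alpha S_{j\alpha}\sigma_\alpha$. Let $\mathcal Q=\mathcal T^*$ be the dual of the tautological bundle of $G(r,N)$ and let $h_{Gr}$ be the metric on $\mathcal Q$ dual to the flat metric $h_0(v,w)=w^*v$ on $\mathcal T$. Then $E\cong i_{\underline s}^*\mathcal Q$ (a vector $v\in E_x$ corresponds to the functional $(\xi(s_1(x)),\dots,\xi(s_N(x)))\mapsto\xi(v)$ on $i_{\underline s}(x)$), and $E$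 carries the hermitian metric $h_{\underline s}=i_{\underline s}^*h_{Gr}$. The basis $\underline s$ is called $\omega$-balanced if $$\frac1{V(M)}\int_M h_{\underline s}(s_j,s_k)\,\frac{\omega^n}{n!}=\frac rN\,\delta_{jk}\qquad(1\le j,k\le N),\qquad V(M)=\int_M\frac{\omega^n}{n!}.$$ **Theorem.** If $\underline s$ and $\tilde{\underline s}$ are two $\omega$-balanced bases of $H^0(M,E)$, then there exist a unitary matrix $U=(U_{jk})\in U(N)$ and an $F\in\operatorname{Aut}(E)$, that is, an invertible holomorphic bundle map $F:E\to E$ over $\mathrm{id}_M$, such that $\tilde{\underline s}=UF\underline s$, i.e. $\tilde s_j=\sum_{k=1}^N U_{jk}\,F s_k$ for $j=1,\dots,N$. -/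

import Mathlib

open scoped Manifold ContDiff Bundle InnerProductSpace
open Bundle MeasureTheory Module

noncomputable section

/-! ### Complex manifolds and Kähler forms

Complex manifolds of dimension `n` are modelled on `EuclideanSpace ℂ (Fin n)`, and
`IsManifold 𝓘(ℂ, EuclideanSpace ℂ (Fin n)) ω M` says that the changes of charts are complex
analytic. -/

/-- The expression in the chart `e` of a field `Ω` of real alternating `2`-forms on the tangent
spaces of `M`: the pull-back of `Ω` under `e.symm`, a real `2`-form on `e.target ⊆ ℂⁿ`. -/
def localTwoForm {n : ℕ} {M : Type*} [TopologicalSpace M]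
    [ChartedSpace (EuclideanSpace ℂ (Fin n)) M]
    (Ω : ∀ x : M, TangentSpace 𝓘(ℂ, EuclideanSpace ℂ (Fin n)) x [⋀^Fin 2]→L[ℝ] ℝ)
    (e : OpenPartialHomeomorph M (EuclideanSpace ℂ (Fin n))) (y : EuclideanSpace ℂ (Fin n)) :
    (EuclideanSpace ℂ (Fin n)) [⋀^Fin 2]→L[ℝ] ℝ :=
  (Ω (e.symm y)).compContinuousLinearMap
    (((mfderiv 𝓘(ℂ, EuclideanSpace ℂ (Fin n)) 𝓘(ℂ, EuclideanSpace ℂ (Fin n)) e.symm y).comp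
      (NormedSpace.fromTangentSpace y).symm.toContinuousLinearMap).restrictScalars ℝ)

/-- A Kähler form on the complex manifold `M`: a smooth closed real `2`-form of type `(1,1)`
(that is, invariant under the complex structure) such that `Ω(u, iu) > 0` for `u ≠ 0`. -/
structure KahlerForm (n : ℕ) (M : Type*) [TopologicalSpace M]
    [ChartedSpace (EuclideanSpace ℂ (Fin n)) M] where
  /-- the form on each tangent space -/
  form : ∀ x : M, TangentSpace 𝓘(ℂ, EuclideanSpace ℂ (Fin n)) x [⋀^Fin 2]→L[ℝ] ℝ
  smooth : ∀ e ∈ atlas (EuclideanSpace ℂ (Fin n)) M, ContDiffOn ℝ ∞ (localTwoForm form e) e.target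
  closed : ∀ e ∈ atlas (EuclideanSpace ℂ (Fin n)) M, ∀ y ∈ e.target,
    extDeriv (localTwoForm form e) y = 0
  type_one_one : ∀ (x : M) (u v : TangentSpace 𝓘(ℂ, EuclideanSpace ℂ (Fin n)) x),
    form x ![Complex.I • u, Complex.I • v] = form x ![u, v]
  pos : ∀ (x : M) (u : TangentSpace 𝓘(ℂ, EuclideanSpace ℂ (Fin n)) x), u ≠ 0 →
    0 < form x ![u, Complex.I • u]

/-- The `m`-th exterior power `α ∧ ⋯ ∧ α` of a real `2`-form `α`, evaluated at the `2m` vectors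
`v (0,0), v (0,1), v (1,0), v (1,1), …`. -/
def wedgePower {V : Type*} [AddCommGroup V] [Module ℝ V] [TopologicalSpace V]
    (α : V [⋀^Fin 2]→L[ℝ] ℝ) (m : ℕ) (v : Fin m × Fin 2 → V) : ℝ :=
  (1 / 2 ^ m : ℝ) * ∑ σ : Equiv.Perm (Fin m × Fin 2),
    ((Equiv.Perm.sign σ : ℤ) : ℝ) * ∏ i : Fin m, α ![v (σ (i, 0)), v (σ (i, 1))]

/-- The real basis `e₁, i e₁, …, eₙ, i eₙ` of `ℂⁿ`, positively oriented. -/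
def stdRealFrame (n : ℕ) (p : Fin n × Fin 2) : EuclideanSpace ℂ (Fin n) :=
  EuclideanSpace.single p.1 (![1, Complex.I] p.2)

section Volume

variable {n : ℕ} {M : Type*} [TopologicalSpace M] [ChartedSpace (EuclideanSpace ℂ (Fin n)) M]

/-- The function `f` with `Ωⁿ / n! = f dx₁ ∧ dy₁ ∧ ⋯ ∧ dxₙ ∧ dyₙ` in the chart `e`. -/
def volumeDensity (Ω : KahlerForm n M) (e : OpenPartialHomeomorph M (EuclideanSpace ℂ (Fin n)))
    (y : EuclideanSpace ℂ (Fin n)) : ℝ :=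
  wedgePower (localTwoForm Ω.form e y) n (stdRealFrame n) / (n.factorial : ℝ)

/-- The measure defined by `Ωⁿ / n!` on the domain of the chart `e` (and zero outside). -/
def chartVolume [MeasurableSpace M] (Ω : KahlerForm n M)
    (e : OpenPartialHomeomorph M (EuclideanSpace ℂ (Fin n))) : Measure M :=
  (((volume : Measure (EuclideanSpace ℂ (Fin n))).restrict e.target).withDensity
    (fun y => ENNReal.ofReal (volumeDensity Ω e y))).map e.symm

variable (n M) in
theorem exists_partitionOfUnity_chart [CompactSpace M] [T2Space M] :
    ∃ ρ : PartitionOfUnity M M Set.univ,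
      ρ.IsSubordinate (fun c : M => (chartAt (EuclideanSpace ℂ (Fin n)) c).source) :=
  PartitionOfUnity.exists_isSubordinate isClosed_univ _
    (fun c => (chartAt (EuclideanSpace ℂ (Fin n)) c).open_source)
    (fun x _ => Set.mem_iUnion.2 ⟨x, mem_chart_source _ x⟩)

/-- The measure `Ωⁿ / n!` on the compact manifold `M`, obtained from the local measures with a
partition of unity `ρ` subordinate to the charts: `∫ f Ωⁿ/n! = ∑ ∫ ρ_c f Ωⁿ/n!`, where the
`c`-th integral is computed in the chart at `c`. (It does not depend on `ρ`.) -/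
def kahlerVolume [CompactSpace M] [T2Space M] [MeasurableSpace M] (Ω : KahlerForm n M) :
    Measure M :=
  Measure.sum fun c : M =>
    (chartVolume Ω (chartAt (EuclideanSpace ℂ (Fin n)) c)).withDensity
      (fun x => ENNReal.ofReal ((exists_partitionOfUnity_chart n M).choose c x))

end Volume

/-! ### The Grassmannian and its canonical metric -/

/-- The Grassmannian `G(r, N)` of `r`-dimensional subspaces of `ℂᴺ`. The fibre over `T` of the
tautological bundle is `T` itself, and the fibre over `T` of the quotient bundle `𝒬 = 𝒯*` is the
dual space of `T`. -/
structure ComplexGrassmannian (r N : ℕ) where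
  /-- the subspace of `ℂᴺ` -/
  space : Submodule ℂ (EuclideanSpace ℂ (Fin N))
  finrank_eq : finrank ℂ space = r

/-- The metric `h_Gr` on the fibre `T*` of the quotient bundle, the dual of the flat metric
`h₀(v, w) = w* v` on `T`: the inner product of the vectors of `T` that represent `φ` and `ψ`.
Mathlib's inner product `innerSL ℂ a b` is linear in `b`, and the Riesz map `toDual.symm` is
conjugate linear, so that `hGr` is linear in `φ` and conjugate linear in `ψ`. -/
def hGr {r N : ℕ} (T : ComplexGrassmannian r N) (φ ψ : Dual ℂ T.space) : ℂ :=
  innerSL ℂ ((InnerProductSpace.toDual ℂ T.space).symm φ.toContinuousLinearMap)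
    ((InnerProductSpace.toDual ℂ T.space).symm ψ.toContinuousLinearMap)

/-! ### Holomorphic vector bundles of rank `r` over `M`, and the Kodaira map -/

section HolomorphicBundle

variable {n r N : ℕ} {M : Type*} [TopologicalSpace M] [ChartedSpace (EuclideanSpace ℂ (Fin n)) M]
  {E : M → Type*} [TopologicalSpace (TotalSpace (EuclideanSpace ℂ (Fin r)) E)]
  [∀ x, AddCommGroup (E x)] [∀ x, Module ℂ (E x)] [∀ x, TopologicalSpace (E x)]
  [FiberBundle (EuclideanSpace ℂ (Fin r)) E] [VectorBundle ℂ (EuclideanSpace ℂ (Fin r)) E]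

variable (n r E) in
/-- `H⁰(M, E)`, the complex vector space of global holomorphic sections of `E`. -/
abbrev HolSections : Type _ :=
  ContMDiffSection 𝓘(ℂ, EuclideanSpace ℂ (Fin n)) (EuclideanSpace ℂ (Fin r)) ω E

variable (n r E) in
/-- `E` is very ample: `H⁰(M, E)` generates every fibre, so that it defines a Kodaira map
`x ↦ ker (s ↦ s x)` to a Grassmannian, and this map is injective and immersive. The derivative
of the Kodaira map along a tangent vector `v` at `x` is the linear map
`ker (s ↦ s x) → E x`, `s ↦ ∂_v s`, so that immersive means: for `v ≠ 0` there is a section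
vanishing at `x` with non-zero derivative along `v` (in a local trivialization). Over a compact
base an injective immersion is an embedding. -/
structure IsVeryAmple : Prop where
  generated : ∀ (x : M) (v : E x), ∃ s : HolSections n r E, s x = v
  injective : ∀ x y : M, (∀ s : HolSections n r E, s x = 0 ↔ s y = 0) → x = y
  immersive : ∀ (x : M) (v : TangentSpace 𝓘(ℂ, EuclideanSpace ℂ (Fin n)) x), v ≠ 0 →
    ∃ s : HolSections n r E, s x = 0 ∧
      mfderiv 𝓘(ℂ, EuclideanSpace ℂ (Fin n)) 𝓘(ℂ, EuclideanSpace ℂ (Fin r))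
        (fun y => (trivializationAt (EuclideanSpace ℂ (Fin r)) E x ⟨y, s y⟩).2) x v ≠ 0

/-- The map `ξ ↦ (ξ (s₁ x), …, ξ (s_N x))` from the dual of `E x` to `ℂᴺ`. In a local frame
`σ₁, …, σ_r` with `s_j = ∑ S_{jα} σ_α` its matrix in the dual frame is `S x`. -/
def kodairaLin (s : Fin N → HolSections n r E) (x : M) :
    Dual ℂ (E x) →ₗ[ℂ] EuclideanSpace ℂ (Fin N) where
  toFun ξ := WithLp.toLp 2 fun j => ξ (s j x)
  map_add' _ _ := rfl
  map_smul' _ _ := rfl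

theorem kodairaLin_injective (hE : IsVeryAmple n r E) (s : Basis (Fin N) ℂ (HolSections n r E))
    (x : M) : Function.Injective (kodairaLin (fun j => s j) x) := by
  rw [injective_iff_map_eq_zero]
  intro ξ hξ
  have h0 : ∀ j, ξ (s j x) = 0 := fun j => congrArg (fun w => w j) hξ
  ext v
  obtain ⟨t, rfl⟩ := hE.generated x v
  let ev : HolSections n r E →ₗ[ℂ] ℂ :=
    { toFun := fun t => ξ (t x)
      map_add' := fun a b => by simp
      map_smul' := fun c a => by simp }
  have hev : ev = 0 := s.ext fun j => h0 j
  exact LinearMap.congr_fun hev t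

theorem finrank_dual_fiber (x : M) : finrank ℂ (Dual ℂ (E x)) = r := by
  have e := Trivialization.linearEquivAt ℂ (trivializationAt (EuclideanSpace ℂ (Fin r)) E x) x
    (FiberBundle.mem_baseSet_trivializationAt' x)
  rw [Subspace.dual_finrank_eq, e.finrank_eq, finrank_euclideanSpace_fin]

/-- The Kodaira map `i_s : M → G(r, N)` of a basis `s` of `H⁰(M, E)`: in a local frame `i_s x` is
the column space of the `N × r` matrix `S x`. -/
def kodairaMap (hE : IsVeryAmple n r E) (s : Basis (Fin N) ℂ (HolSections n r E)) (x : M) :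
    ComplexGrassmannian r N where
  space := LinearMap.range (kodairaLin (fun j => s j) x)
  finrank_eq := by
    rw [LinearMap.finrank_range_of_inj (kodairaLin_injective hE s x), finrank_dual_fiber (r := r) x]

/-- The identification of `E x` with the fibre of `i_s^* 𝒬` at `x`, that is with the dual of
`i_s x`: the vector `v` gives the functional `(ξ (s₁ x), …, ξ (s_N x)) ↦ ξ v`. -/
def toQuotientFiber (hE : IsVeryAmple n r E) (s : Basis (Fin N) ℂ (HolSections n r E)) (x : M)
    (v : E x) : Dual ℂ (kodairaMap hE s x).space :=
  (Dual.eval ℂ (E x) v).comp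
    (LinearEquiv.ofInjective (kodairaLin (fun j => s j) x)
      (kodairaLin_injective hE s x)).symm.toLinearMap

/-- The hermitian metric `h_s = i_s^* h_Gr` on `E`, linear in the first argument. -/
def inducedMetric (hE : IsVeryAmple n r E) (s : Basis (Fin N) ℂ (HolSections n r E)) (x : M)
    (v w : E x) : ℂ :=
  hGr (kodairaMap hE s x) (toQuotientFiber hE s x v) (toQuotientFiber hE s x w)

/-- The `L²`-product `(1 / V(M)) ∫_M h_s(t, u) Ωⁿ / n!` on `H⁰(M, E)`, with
`V(M) = ∫_M Ωⁿ / n!`. -/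
def l2Product [CompactSpace M] [T2Space M] [MeasurableSpace M] (Ω : KahlerForm n M)
    (hE : IsVeryAmple n r E) (s : Basis (Fin N) ℂ (HolSections n r E))
    (t u : HolSections n r E) : ℂ :=
  (1 / ((kahlerVolume Ω).real Set.univ : ℂ)) *
    ∫ x, inducedMetric hE s x (t x) (u x) ∂(kahlerVolume Ω)

/-- The basis `s` of `H⁰(M, E)` is `Ω`-balanced: `⟨s_j, s_k⟩ = (r / N) δ_{jk}` for the
`L²`-product of the metric `h_s`. -/
def IsBalancedBasis [CompactSpace M] [T2Space M] [MeasurableSpace M] (Ω : KahlerForm n M)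
    (hE : IsVeryAmple n r E) (s : Basis (Fin N) ℂ (HolSections n r E)) : Prop :=
  ∀ j k : Fin N, l2Product Ω hE s (s j) (s k) = if j = k then (r : ℂ) / (N : ℂ) else 0

variable (n r E) in
/-- `Aut(E)`: the invertible holomorphic bundle maps of `E` to itself (over the identity
of `M`). -/
structure HolBundleAut where
  /-- the action on each fibre -/
  onFiber : ∀ x : M, E x ≃ₗ[ℂ] E x
  holomorphic : ContMDiff (𝓘(ℂ, EuclideanSpace ℂ (Fin n)).prod 𝓘(ℂ, EuclideanSpace ℂ (Fin r)))
    (𝓘(ℂ, EuclideanSpace ℂ (Fin n)).prod 𝓘(ℂ, EuclideanSpace ℂ (Fin r))) ω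
    (fun p : TotalSpace (EuclideanSpace ℂ (Fin r)) E =>
      (⟨p.1, onFiber p.1 p.2⟩ : TotalSpace (EuclideanSpace ℂ (Fin r)) E))
  holomorphic_inv : ContMDiff (𝓘(ℂ, EuclideanSpace ℂ (Fin n)).prod 𝓘(ℂ, EuclideanSpace ℂ (Fin r)))
    (𝓘(ℂ, EuclideanSpace ℂ (Fin n)).prod 𝓘(ℂ, EuclideanSpace ℂ (Fin r))) ω
    (fun p : TotalSpace (EuclideanSpace ℂ (Fin r)) E =>
      (⟨p.1, (onFiber p.1).symm p.2⟩ : TotalSpace (EuclideanSpace ℂ (Fin r)) E))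

end HolomorphicBundle

end

/-! Write `s' = A s`, and let `P x`, `Q x` be the orthogonal projections of `ℂᴺ` onto `i_s x` and
`i_{s'} x = A (i_s x)`. The Gram matrix of `s` for `h_s` at `x` is `P x` (`inducedMetric_basis`), so
balance says that `P` and `Q` both have average `(r/N)·1`.

Since `Q A P = A P`, the function `tr (Q A Aᴴ) - tr (P Aᴴ A)` equals `‖Q A (1 - P)‖²`, which is
nonnegative. Its integral is a multiple of `tr (A Aᴴ) - tr (Aᴴ A) = 0`. It is continuous and `Ωⁿ/n!`
charges every nonempty open set, so it vanishes identically. Hence `Q A = A P`, and `Aᴴ A` commutes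
with every `P x` (`commute_projectionMatrix_of_isBalancedBasis`).

In the polar decomposition `A = U R`, the factor `R = √(Aᴴ A)` then commutes with every `P x` as
well. So `R` preserves every `i_s x` and, by duality, acts on every fibre `E x`. These actions form
a holomorphic automorphism `F` with `F s = R s` (`exists_holBundleAut_of_commute`), and `s' = U R s
= U F s`. -/

noncomputable section

/-! ### Polar decomposition and the trace identity for projections -/

section MatrixLemmas

open Matrix
open scoped ComplexOrder MatrixOrder

variable {ι : Type*} [Fintype ι] [DecidableEq ι]

/-- `R` is the positive square root of `Aᴴ A`. As a continuous function of `Aᴴ A` it inherits its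
commutant, which is how commutation with all the projections passes to `R`. -/
theorem exists_polarDecomposition (A : Matrix ι ι ℂ) (hA : IsUnit A) :
    ∃ R : Matrix ι ι ℂ, IsUnit R ∧ A * R⁻¹ ∈ Matrix.unitaryGroup ι ℂ ∧
      ∀ P : Matrix ι ι ℂ, Commute (Aᴴ * A) P → Commute R P := by
  have hK : 0 ≤ Aᴴ * A := (Matrix.posSemidef_conjTranspose_mul_self A).nonneg
  set R := CFC.sqrt (Aᴴ * A) with hR
  have hRR : R * R = Aᴴ * A := CFC.sqrt_mul_sqrt_self _ hK
  have hRs : Rᴴ = R := (CFC.sqrt_nonneg (Aᴴ * A)).posSemidef.1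
  have hKu : IsUnit (Aᴴ * A) := ((Matrix.isUnit_conjTranspose A).2 hA).mul hA
  have hRu : IsUnit R := by
    rw [← hRR] at hKu
    exact isUnit_of_mul_isUnit_left hKu
  have hRd := (Matrix.isUnit_iff_isUnit_det _).1 hRu
  refine ⟨R, hRu, ?_, fun P hP => hP.cfcₙ_nnreal _⟩
  rw [Matrix.mem_unitaryGroup_iff', Matrix.star_eq_conjTranspose, Matrix.conjTranspose_mul,
    Matrix.conjTranspose_nonsing_inv, hRs, Matrix.mul_assoc, ← Matrix.mul_assoc Aᴴ, ← hRR,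
    Matrix.mul_assoc R, Matrix.mul_nonsing_inv _ hRd, Matrix.mul_one,
    Matrix.nonsing_inv_mul _ hRd]

/-- If the range of the projection `Q` contains `A` times the range of the projection `P`, then
the trace of `Q A Aᴴ` exceeds that of `P Aᴴ A` by the square of the Hilbert–Schmidt norm of
`Q A (1 - P)`. -/
theorem trace_projection_sub_trace_projection {A P Q : Matrix ι ι ℂ} (hP : P.IsHermitian)
    (hP2 : P * P = P) (hQ : Q.IsHermitian) (hQ2 : Q * Q = Q) (hPQ : Q * (A * P) = A * P) :
    (Q * (A * Aᴴ)).trace - (P * (Aᴴ * A)).trace =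
      ((Q * A * (1 - P))ᴴ * (Q * A * (1 - P))).trace := by
  have hPQ' : P * Aᴴ * Q = P * Aᴴ := by
    have := congrArg conjTranspose hPQ
    simpa [Matrix.conjTranspose_mul, hP.eq, hQ.eq] using this
  -- The square of `Q A - A P` has four terms; each of the three involving `P` has trace `± tr (P Aᴴ
  -- A)`.
  have h1 : Q * A * (1 - P) = Q * A - A * P := by
    rw [Matrix.mul_sub, Matrix.mul_one, Matrix.mul_assoc, hPQ]
  rw [h1, Matrix.conjTranspose_sub, Matrix.conjTranspose_mul, Matrix.conjTranspose_mul, hP.eq,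
    hQ.eq, Matrix.sub_mul, Matrix.mul_sub, Matrix.mul_sub]
  have e1 : Aᴴ * Q * (Q * A) = Aᴴ * (Q * A) := by
    rw [Matrix.mul_assoc, ← Matrix.mul_assoc Q Q A, hQ2]
  have e2 : P * Aᴴ * (Q * A) = P * Aᴴ * A := by
    rw [← Matrix.mul_assoc, hPQ']
  have e3 : Aᴴ * Q * (A * P) = Aᴴ * (A * P) := by
    rw [Matrix.mul_assoc, hPQ]
  have e4 : (Aᴴ * (A * P)).trace = (P * Aᴴ * A).trace := by
    rw [← Matrix.mul_assoc, Matrix.trace_mul_comm, Matrix.mul_assoc]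
  have e5 : (P * Aᴴ * (A * P)).trace = (P * Aᴴ * A).trace := by
    rw [← Matrix.mul_assoc, Matrix.trace_mul_comm, ← Matrix.mul_assoc, ← Matrix.mul_assoc, hP2]
  have e6 : (Aᴴ * (Q * A)).trace = (Q * (A * Aᴴ)).trace := by
    rw [Matrix.trace_mul_comm, Matrix.mul_assoc]
  rw [e1, e2, e3, Matrix.trace_sub, Matrix.trace_sub, Matrix.trace_sub, e4, e5, e6,
    Matrix.mul_assoc P]
  ring

/-- The equality case gives `Q A = A P`, with adjoint `Aᴴ Q = P Aᴴ`; therefore `Aᴴ A P = Aᴴ Q A = P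
Aᴴ A`. -/
theorem commute_of_mul_one_sub_eq_zero {A P Q : Matrix ι ι ℂ} (hP : P.IsHermitian)
    (hQ : Q.IsHermitian) (hPQ : Q * (A * P) = A * P) (h : Q * A * (1 - P) = 0) :
    Commute (Aᴴ * A) P := by
  have h1 : Q * A = A * P := by
    rw [Matrix.mul_sub, Matrix.mul_one, Matrix.mul_assoc, hPQ, sub_eq_zero] at h
    exact h
  have h2 : Aᴴ * Q = P * Aᴴ := by
    simpa [Matrix.conjTranspose_mul, hP.eq, hQ.eq] using congrArg conjTranspose h1
  rw [Commute, SemiconjBy, Matrix.mul_assoc, ← h1, ← Matrix.mul_assoc, h2, Matrix.mul_assoc]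

end MatrixLemmas

/-! ### Top exterior powers of a real two-form -/

section Wedge

/-- The multilinear map `v ↦ ∏ i, α (v (i, 0)) (v (i, 1))`. -/
def pairingProduct {V : Type*} [AddCommGroup V] [Module ℝ V] [TopologicalSpace V]
    (α : V [⋀^Fin 2]→L[ℝ] ℝ) (m : ℕ) : MultilinearMap ℝ (fun _ : Fin m × Fin 2 => V) ℝ :=
  ((MultilinearMap.mkPiAlgebra ℝ (Fin m) ℝ).compMultilinearMap
    (fun _ => α.toAlternatingMap.toMultilinearMap)).domDomCongr (Equiv.sigmaEquivProd _ _)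

theorem pairingProduct_apply {V : Type*} [AddCommGroup V] [Module ℝ V] [TopologicalSpace V]
    (α : V [⋀^Fin 2]→L[ℝ] ℝ) (m : ℕ) (v : Fin m × Fin 2 → V) :
    pairingProduct α m v = ∏ i, α ![v (i, 0), v (i, 1)] := by
  simp only [pairingProduct, MultilinearMap.domDomCongr_apply]
  rw [MultilinearMap.compMultilinearMap_apply, MultilinearMap.mkPiAlgebra_apply]
  refine Finset.prod_congr rfl fun i _ => ?_
  change α _ = α _
  congr 1
  ext b
  fin_cases b <;> rfl

/-- Exhibits `αᵐ` as an alternating map, so that in top degree it scales by determinants. -/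
theorem wedgePower_eq_alternatization {V : Type*} [AddCommGroup V] [Module ℝ V]
    [TopologicalSpace V] (α : V [⋀^Fin 2]→L[ℝ] ℝ) (m : ℕ) (v : Fin m × Fin 2 → V) :
    wedgePower α m v = (1 / 2 ^ m : ℝ) * MultilinearMap.alternatization (pairingProduct α m) v := by
  rw [wedgePower, MultilinearMap.alternatization_apply]
  congr 1
  refine Finset.sum_congr rfl fun σ _ => ?_
  rw [MultilinearMap.domDomCongr_apply, pairingProduct_apply, Units.smul_def, zsmul_eq_mul]

/-- The values of the standard symplectic form on the symplectic basis indexed by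
`Fin m × Fin 2`. -/
def symplecticSign {m : ℕ} (p q : Fin m × Fin 2) : ℝ :=
  if p.1 = q.1 then (if p.2 = q.2 then 0 else if p.2 = 0 then 1 else -1) else 0

/-- If no factor vanishes, `σ` carries each pair `(i,0), (i,1)` to such a pair, so it is a
permutation `τ` of the pairs composed with flips inside them. `τ` acts on two copies and has sign
`(sign τ)² = 1`; each flip contributes `-1` both to the sign and to the product. -/
theorem sign_mul_prod_symplecticSign_nonneg {m : ℕ} (σ : Equiv.Perm (Fin m × Fin 2)) :
    0 ≤ ((Equiv.Perm.sign σ : ℤ) : ℝ) * ∏ i, symplecticSign (σ (i, 0)) (σ (i, 1)) := by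
  by_cases h : ∃ i, symplecticSign (σ (i, 0)) (σ (i, 1)) = 0
  · obtain ⟨i, hi⟩ := h
    rw [Finset.prod_eq_zero (Finset.mem_univ i) hi, mul_zero]
  push Not at h
  have h1 : ∀ i, (σ (i, 0)).1 = (σ (i, 1)).1 := fun i => by
    by_contra hne
    exact h i (if_neg hne)
  have h2 : ∀ i, (σ (i, 0)).2 ≠ (σ (i, 1)).2 := fun i he => by
    apply h i
    rw [symplecticSign, if_pos (h1 i), if_pos he]
  have hτ : Function.Injective fun i => (σ (i, 0)).1 := by
    intro i j hij
    dsimp only at hij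
    have : σ (j, 0) = σ (i, 0) ∨ σ (j, 0) = σ (i, 1) := by
      have hi := h2 i
      have : (σ (j, 0)).2 = (σ (i, 0)).2 ∨ (σ (j, 0)).2 = (σ (i, 1)).2 := by
        generalize (σ (j, 0)).2 = a at *
        generalize (σ (i, 0)).2 = b at *
        generalize (σ (i, 1)).2 = c at *
        omega
      rcases this with e | e
      · exact Or.inl (Prod.ext hij.symm e)
      · exact Or.inr (Prod.ext (hij.symm.trans (h1 i)) e)
    rcases this with e | e
    · exact (congrArg Prod.fst (σ.injective e)).symm
    · exact (congrArg Prod.fst (σ.injective e)).symm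
  let τ : Equiv.Perm (Fin m) := Equiv.ofBijective _ (Finite.injective_iff_bijective.1 hτ)
  let ν : Fin m → Equiv.Perm (Fin 2) := fun i => if (σ (i, 0)).2 = 0 then 1 else Equiv.swap 0 1
  have hσ : σ = (Equiv.prodCongrLeft fun _ : Fin 2 => τ) * Equiv.prodCongrRight ν := by
    ext1 ⟨i, b⟩
    have hi := h2 i
    have hi1 := h1 i
    rw [Equiv.Perm.mul_apply, Equiv.prodCongrRight_apply, Equiv.prodCongrLeft_apply]
    change _ = ((σ (i, 0)).1, ν i b)
    refine Prod.ext ?_ ?_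
    · fin_cases b
      · rfl
      · exact hi1.symm
    · dsimp only [ν]
      split_ifs with h0
      · fin_cases b
        · simpa using h0
        · simp only [Equiv.Perm.coe_one, id]
          simp only [Fin.mk_one]
          omega
      · fin_cases b
        · simp only [Fin.zero_eta, Equiv.swap_apply_left]; omega
        · simp only [Fin.mk_one, Equiv.swap_apply_right]; omega
  have hs : ((Equiv.Perm.sign σ : ℤ) : ℝ) = ∏ i, ((Equiv.Perm.sign (ν i) : ℤ) : ℝ) := by
    conv_lhs => rw [hσ]
    rw [Equiv.Perm.sign_mul, Equiv.Perm.sign_prodCongrLeft, Equiv.Perm.sign_prodCongrRight]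
    simp
  rw [hs, ← Finset.prod_mul_distrib]
  refine Finset.prod_nonneg fun i _ => ?_
  rw [symplecticSign, if_pos (h1 i), if_neg (h2 i)]
  dsimp only [ν]
  split_ifs with h0
  · simp
  · simp

/-- Every permutation contributes a nonnegative term, and the identity contributes the strictly
positive `∏ i, c i`. -/
theorem wedgePower_pos_of_symplectic {V : Type*} [AddCommGroup V] [Module ℝ V]
    [TopologicalSpace V] (α : V [⋀^Fin 2]→L[ℝ] ℝ) (m : ℕ) (v : Fin m × Fin 2 → V) (c : Fin m → ℝ)
    (hc : ∀ i, 0 < c i) (hv : ∀ p q, α ![v p, v q] = c p.1 * symplecticSign p q) :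
    0 < wedgePower α m v := by
  refine mul_pos (by positivity) ?_
  have key : ∀ σ : Equiv.Perm (Fin m × Fin 2),
      ((Equiv.Perm.sign σ : ℤ) : ℝ) * ∏ i : Fin m, α ![v (σ (i, 0)), v (σ (i, 1))] =
      (∏ i, c (σ (i, 0)).1) *
        (((Equiv.Perm.sign σ : ℤ) : ℝ) * ∏ i, symplecticSign (σ (i, 0)) (σ (i, 1))) := by
    intro σ
    simp_rw [hv, Finset.prod_mul_distrib]
    ring
  refine Finset.sum_pos' (fun σ _ => ?_) ⟨1, Finset.mem_univ _, ?_⟩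
  · rw [key]
    exact mul_nonneg (Finset.prod_nonneg fun i _ => (hc _).le)
      (sign_mul_prod_symplecticSign_nonneg σ)
  · rw [key]
    refine mul_pos (Finset.prod_pos fun i _ => hc _) ?_
    simp [symplecticSign]

theorem exists_basis_stdRealFrame (n : ℕ) :
    ∃ b : Basis (Fin n × Fin 2) ℝ (EuclideanSpace ℂ (Fin n)), ⇑b = stdRealFrame n := by
  refine ⟨(Complex.basisOneI.smulTower'
    (EuclideanSpace.basisFun (Fin n) ℂ).toBasis), ?_⟩
  ext p i
  rw [Basis.smulTower'_apply]
  simp only [stdRealFrame, Complex.coe_basisOneI]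
  simp

/-- A complex linear automorphism has real determinant `|det g|² > 0`, so the sign of a top-degree
form can be tested on any complex basis. -/
theorem wedgePower_comp_pos_iff {n : ℕ}
    (α : (EuclideanSpace ℂ (Fin n)) [⋀^Fin 2]→L[ℝ] ℝ)
    (g : EuclideanSpace ℂ (Fin n) ≃ₗ[ℂ] EuclideanSpace ℂ (Fin n)) :
    0 < wedgePower α n (fun p => g (stdRealFrame n p)) ↔ 0 < wedgePower α n (stdRealFrame n) := by
  obtain ⟨b, hb⟩ := exists_basis_stdRealFrame n
  rw [wedgePower_eq_alternatization, wedgePower_eq_alternatization, ← hb]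
  set f := MultilinearMap.alternatization (pairingProduct α n)
  have hdet : 0 < LinearMap.det (g.toLinearMap.restrictScalars ℝ) := by
    rw [LinearMap.det_restrictScalars, Algebra.norm_complex_apply, Complex.normSq_pos]
    exact (LinearEquiv.isUnit_det' g).ne_zero
  have : f (fun p => g (b p)) = LinearMap.det (g.toLinearMap.restrictScalars ℝ) * f b := by
    conv_lhs => rw [f.eq_smul_basis_det b]
    have := Basis.det_comp b (g.toLinearMap.restrictScalars ℝ) b
    rw [Basis.det_self, mul_one] at this
    rw [AlternatingMap.smul_apply, smul_eq_mul, mul_comm, ← this]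
    rfl
  rw [this]
  have h2 : (0 : ℝ) < 1 / 2 ^ n := by positivity
  rw [mul_pos_iff_of_pos_left h2, mul_pos_iff_of_pos_left h2, mul_pos_iff_of_pos_left hdet]

end Wedge

/-! ### Positive `(1,1)`-forms have positive top power -/

section Positivity

open Matrix

variable {V : Type*} [AddCommGroup V] [Module ℝ V] [TopologicalSpace V]

theorem twoForm_add_left (α : V [⋀^Fin 2]→L[ℝ] ℝ) (u u' v : V) :
    α ![u + u', v] = α ![u, v] + α ![u', v] := by
  simpa using α.map_vecCons_add ![v] u u'

theorem twoForm_swap (α : V [⋀^Fin 2]→L[ℝ] ℝ) (u v : V) : α ![u, v] = -α ![v, u] := by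
  have h : α (![v, u] ∘ Equiv.swap 0 1) = -α ![v, u] :=
    α.toAlternatingMap.map_swap ![v, u] (show (0 : Fin 2) ≠ 1 by decide)
  rw [← h]
  congr 1
  ext i
  fin_cases i <;> rfl

theorem twoForm_add_right (α : V [⋀^Fin 2]→L[ℝ] ℝ) (u v v' : V) :
    α ![u, v + v'] = α ![u, v] + α ![u, v'] := by
  rw [twoForm_swap, twoForm_add_left, twoForm_swap α u v, twoForm_swap α u v']
  ring

theorem twoForm_smul_left (α : V [⋀^Fin 2]→L[ℝ] ℝ) (c : ℝ) (u v : V) :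
    α ![c • u, v] = c * α ![u, v] := by
  simpa using α.map_vecCons_smul ![v] c u

theorem twoForm_smul_right (α : V [⋀^Fin 2]→L[ℝ] ℝ) (c : ℝ) (u v : V) :
    α ![u, c • v] = c * α ![u, v] := by
  rw [twoForm_swap, twoForm_smul_left, twoForm_swap α u v]
  ring

variable {n : ℕ} (α : (EuclideanSpace ℂ (Fin n)) [⋀^Fin 2]→L[ℝ] ℝ)

/-- The sesquilinear form `h(u, v) = α(u, iv) + i α(u, v)` of a `2`-form of type `(1,1)`, conjugate
linear in the first argument. -/
def hermitianForm (hα : ∀ u v, α ![Complex.I • u, Complex.I • v] = α ![u, v]) :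
    EuclideanSpace ℂ (Fin n) →ₗ⋆[ℂ] EuclideanSpace ℂ (Fin n) →ₗ[ℂ] ℂ :=
  LinearMap.mk₂'ₛₗ _ _ (fun u v => (⟨α ![u, Complex.I • v], α ![u, v]⟩ : ℂ))
    (fun u u' v => by
      apply Complex.ext <;> simp [twoForm_add_left])
    (fun c u v => by
      have h1 : ∀ w, α ![c • u, w] = c.re * α ![u, w] + c.im * α ![Complex.I • u, w] := by
        intro w
        rw [← twoForm_smul_left, ← twoForm_smul_left, ← twoForm_add_left]
        congr 2
        conv_lhs => rw [← Complex.re_add_im c, add_smul, mul_smul]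
        rfl
      have h2 : α ![Complex.I • u, v] = - α ![u, Complex.I • v] := by
        rw [← hα u, smul_smul, Complex.I_mul_I, neg_one_smul, ← neg_one_smul ℝ v,
          twoForm_smul_right]
        ring
      apply Complex.ext
      · simp [h1, hα]
      · simp [h1, h2])
    (fun u v v' => by
      apply Complex.ext <;> simp [twoForm_add_right])
    (fun c u v => by
      have h1 : ∀ w, α ![u, c • w] = c.re * α ![u, w] + c.im * α ![u, Complex.I • w] := by
        intro w
        rw [← twoForm_smul_right, ← twoForm_smul_right, ← twoForm_add_right]
        congr 2
        conv_lhs => rw [← Complex.re_add_im c, add_smul, mul_smul]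
        rfl
      have h2 : α ![u, Complex.I • c • v] = c.re * α ![u, Complex.I • v] - c.im * α ![u, v] := by
        rw [smul_comm, h1, smul_smul Complex.I, Complex.I_mul_I, neg_one_smul,
          ← neg_one_smul ℝ v, twoForm_smul_right]
        ring
      apply Complex.ext
      · simp [h2]
      · simp [h1])

/-- A unitary eigenbasis of the associated Hermitian matrix brings `α` to a diagonal symplectic form
whose coefficients are the eigenvalues, positive by `hpos`. The change of basis is complex linear,
hence preserves the sign of the top power. -/
theorem wedgePower_stdRealFrame_pos
    (hα : ∀ u v, α ![Complex.I • u, Complex.I • v] = α ![u, v])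
    (hpos : ∀ u, u ≠ 0 → 0 < α ![u, Complex.I • u]) :
    0 < wedgePower α n (stdRealFrame n) := by
  set h := hermitianForm α hα with h_def
  have h_apply : ∀ u v, h u v = ⟨α ![u, Complex.I • v], α ![u, v]⟩ := fun u v => rfl
  have h_symm : ∀ u v, h v u = star (h u v) := by
    intro u v
    rw [h_apply, h_apply]
    apply Complex.ext
    · change α ![v, Complex.I • u] = α ![u, Complex.I • v]
      rw [← hα v, smul_smul, Complex.I_mul_I, neg_one_smul, ← neg_one_smul ℝ u,
          twoForm_smul_right, twoForm_swap]
      ring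
    · exact twoForm_swap _ _ _
  let e := (EuclideanSpace.basisFun (Fin n) ℂ)
  let H : Matrix (Fin n) (Fin n) ℂ := Matrix.of fun j k => h (e j) (e k)
  have hH : H.IsHermitian := by
    ext j k
    exact (h_symm _ _).symm
  have hHv : ∀ u v, h u v = inner ℂ u (WithLp.toLp 2 (H *ᵥ v) : EuclideanSpace ℂ (Fin n)) := by
    intro u v
    conv_lhs => rw [← e.sum_repr u, ← e.sum_repr v]
    simp only [map_sum, LinearMap.sum_apply, LinearMap.map_smulₛₗ, LinearMap.smul_apply,
      map_smul, PiLp.inner_apply, Matrix.mulVec, dotProduct, smul_eq_mul, RCLike.inner_apply,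
      Finset.sum_mul, Finset.mul_sum]
    refine Finset.sum_comm.trans (Finset.sum_congr rfl fun i _ => Finset.sum_congr rfl fun j _ => ?_)
    simp [e, H]
    ring
  let b := hH.eigenvectorBasis
  have hb : ∀ p q, h (b p) (b q) = if p = q then (hH.eigenvalues q : ℂ) else 0 := by
    intro p q
    rw [hHv, hH.mulVec_eigenvectorBasis q]
    change inner ℂ (b p) (hH.eigenvalues q • b q) = _
    rw [← Complex.coe_smul, inner_smul_right, orthonormal_iff_ite.1 b.orthonormal]
    simp
  have hre : ∀ p q, α ![b p, Complex.I • b q] = if p = q then hH.eigenvalues q else 0 := by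
    intro p q
    have := congrArg Complex.re (hb p q)
    rw [h_apply] at this
    simp only at this
    rw [this]
    split_ifs <;> simp
  have him : ∀ p q, α ![b p, b q] = 0 := by
    intro p q
    have := congrArg Complex.im (hb p q)
    rw [h_apply] at this
    simp only at this
    rw [this]
    split_ifs <;> simp
  have hlam : ∀ p, 0 < hH.eigenvalues p := by
    intro p
    have h1 := hpos (b p) (b.orthonormal.ne_zero p)
    rwa [hre, if_pos rfl] at h1
  let g : EuclideanSpace ℂ (Fin n) ≃ₗ[ℂ] EuclideanSpace ℂ (Fin n) :=
    e.toBasis.equiv b.toBasis (Equiv.refl _)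
  have hg : ∀ p, g (stdRealFrame n p) = (![1, Complex.I] p.2 : ℂ) • b p.1 := by
    intro p
    have : stdRealFrame n p = (![1, Complex.I] p.2 : ℂ) • e.toBasis p.1 := by
      ext i
      simp [stdRealFrame, e]
    rw [this, map_smul, Basis.equiv_apply]
    simp
  rw [← wedgePower_comp_pos_iff α g]
  refine wedgePower_pos_of_symplectic α n _ hH.eigenvalues hlam ?_
  rintro ⟨p, a⟩ ⟨q, c⟩
  rw [hg, hg]
  fin_cases a <;> fin_cases c
  · simp [him, symplecticSign]
  · simp only [symplecticSign]
    by_cases hpq : p = q <;> simp [hre, hpq]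
  · simp only [symplecticSign]
    rw [twoForm_swap]
    by_cases hpq : p = q
    · simp [hre, hpq]
    · simp [hre, hpq, Ne.symm hpq]
  · simp [him, hα, symplecticSign]

end Positivity

/-! ### The Kähler volume charges every nonempty open set -/

section VolumePositivity

variable {n : ℕ} {M : Type*} [TopologicalSpace M] [ChartedSpace (EuclideanSpace ℂ (Fin n)) M]

/-- The derivative of an inverse chart is complex linear and injective, so type `(1,1)` and
positivity survive the pull-back. -/
theorem volumeDensity_pos [IsManifold 𝓘(ℂ, EuclideanSpace ℂ (Fin n)) ω M] (Ω : KahlerForm n M)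
    {e : OpenPartialHomeomorph M (EuclideanSpace ℂ (Fin n))}
    (he : e ∈ atlas (EuclideanSpace ℂ (Fin n)) M) {y : EuclideanSpace ℂ (Fin n)}
    (hy : y ∈ e.target) : 0 < volumeDensity Ω e y := by
  have : IsManifold 𝓘(ℂ, EuclideanSpace ℂ (Fin n)) 1 M := IsManifold.of_le (n := ω) le_top
  have hinj : Function.Injective
      (mfderiv 𝓘(ℂ, EuclideanSpace ℂ (Fin n)) 𝓘(ℂ, EuclideanSpace ℂ (Fin n)) e.symm y) :=
    (mdifferentiable_of_mem_atlas (I := 𝓘(ℂ, EuclideanSpace ℂ (Fin n))) he).symm.mfderiv_injective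
      (by simpa using hy)
  set L := (mfderiv 𝓘(ℂ, EuclideanSpace ℂ (Fin n)) 𝓘(ℂ, EuclideanSpace ℂ (Fin n)) e.symm y).comp
      (NormedSpace.fromTangentSpace y).symm.toContinuousLinearMap with hL
  have hL_inj : Function.Injective L :=
    hinj.comp (NormedSpace.fromTangentSpace y).symm.injective
  have hform : ∀ u v, localTwoForm Ω.form e y ![u, v] = Ω.form (e.symm y) ![L u, L v] := by
    intro u v
    rw [localTwoForm, ContinuousAlternatingMap.compContinuousLinearMap_apply]
    congr 1
    ext i
    fin_cases i <;> rfl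
  refine div_pos (wedgePower_stdRealFrame_pos _ (fun u v => ?_) fun u hu => ?_) (by positivity)
  · rw [hform, hform, map_smul, map_smul, Ω.type_one_one]
  · rw [hform, map_smul]
    exact Ω.pos _ _ fun h => hu (hL_inj (h.trans (map_zero L).symm))

theorem continuousOn_volumeDensity (Ω : KahlerForm n M)
    {e : OpenPartialHomeomorph M (EuclideanSpace ℂ (Fin n))}
    (he : e ∈ atlas (EuclideanSpace ℂ (Fin n)) M) : ContinuousOn (volumeDensity Ω e) e.target := by
  have h := (Ω.smooth e he).continuousOn
  have hev : ∀ v : Fin 2 → EuclideanSpace ℂ (Fin n),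
      ContinuousOn (fun y => localTwoForm Ω.form e y v) e.target := fun v =>
    (ContinuousAlternatingMap.apply ℝ (EuclideanSpace ℂ (Fin n)) ℝ v).continuous.comp_continuousOn h
  unfold volumeDensity wedgePower
  fun_prop

variable [CompactSpace M] [T2Space M] [MeasurableSpace M] [BorelSpace M]

/-- Needed to pass from a zero integral to pointwise vanishing. Some `ρ c` is positive at a given
point of the open set, and near it the `c`-th summand has positive density with respect to Lebesgue
measure in the chart. -/
theorem isOpenPosMeasure_kahlerVolume [IsManifold 𝓘(ℂ, EuclideanSpace ℂ (Fin n)) ω M]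
    (Ω : KahlerForm n M) : (kahlerVolume Ω).IsOpenPosMeasure := by
  refine ⟨fun V hV ⟨x, hx⟩ h0 => ?_⟩
  set ρ := (exists_partitionOfUnity_chart n M).choose with hρ
  have hsub := (exists_partitionOfUnity_chart n M).choose_spec
  obtain ⟨c, hc⟩ := ρ.exists_pos (Set.mem_univ x)
  set e := chartAt (EuclideanSpace ℂ (Fin n)) c with he_def
  have he : e ∈ atlas (EuclideanSpace ℂ (Fin n)) M := chart_mem_atlas _ c
  set W : Set M := V ∩ {y | 0 < ρ c y} with hW
  have hWo : IsOpen W := hV.inter (isOpen_lt continuous_const (ρ c).continuous)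
  -- The support of `ρ c` lies in the chart domain at `c`, so `W` can be tested in that single
  -- chart.
  have hWs : W ⊆ e.source := fun y hy => hsub c (subset_tsupport _ (ne_of_gt hy.2))
  have h1 : ((chartVolume Ω e).withDensity (fun x => ENNReal.ofReal (ρ c x))) W = 0 := by
    refine le_antisymm ?_ bot_le
    rw [← h0]
    exact (Measure.le_sum (fun c : M => (chartVolume Ω (chartAt (EuclideanSpace ℂ (Fin n)) c)).withDensity
      (fun x => ENNReal.ofReal (ρ c x))) c W).trans (measure_mono Set.inter_subset_left)
  rw [withDensity_apply_eq_zero' (by fun_prop)] at h1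
  have h2 : chartVolume Ω e W = 0 := by
    refine measure_mono_null ?_ h1
    exact fun y hy => ⟨by simpa using hy.2, hy⟩
  have hmeas : AEMeasurable e.symm
      ((volume : Measure (EuclideanSpace ℂ (Fin n))).restrict e.target) :=
    e.continuousOn_symm.aemeasurable e.open_target.measurableSet
  rw [chartVolume, Measure.map_apply_of_aemeasurable
    (hmeas.mono_ac (withDensity_absolutelyContinuous _ _)) hWo.measurableSet,
    withDensity_apply_eq_zero' ((continuousOn_volumeDensity Ω he).aemeasurable
      e.open_target.measurableSet).ennreal_ofReal,
    Measure.restrict_apply₀' e.open_target.measurableSet.nullMeasurableSet] at h2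
  have h3 : (volume : Measure (EuclideanSpace ℂ (Fin n))) (e.target ∩ e.symm ⁻¹' W) = 0 := by
    refine measure_mono_null ?_ h2
    exact fun y hy => ⟨⟨by simpa using volumeDensity_pos Ω he hy.1, hy.2⟩, hy.1⟩
  have hne : (e.target ∩ e.symm ⁻¹' W).Nonempty :=
    ⟨e x, e.map_source (hWs ⟨hx, hc⟩), by
      rw [Set.mem_preimage, e.left_inv (hWs ⟨hx, hc⟩)]; exact ⟨hx, hc⟩⟩
  exact ((e.isOpen_inter_preimage_symm hWo).measure_pos volume hne).ne' h3

end VolumePositivity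

/-! ### Matrices of orthogonal projections -/

section ProjectionMatrix

open Matrix

variable {N : ℕ}

/-- The matrix of the orthogonal projection of `ℂᴺ` onto the subspace `T`. -/
def projectionMatrix (T : Submodule ℂ (EuclideanSpace ℂ (Fin N))) : Matrix (Fin N) (Fin N) ℂ :=
  Matrix.of fun j k => T.starProjection (EuclideanSpace.single k 1) j

theorem projectionMatrix_apply_eq_inner (T : Submodule ℂ (EuclideanSpace ℂ (Fin N)))
    (j k : Fin N) : projectionMatrix T j k =
      inner ℂ (EuclideanSpace.single j (1 : ℂ)) (T.starProjection (EuclideanSpace.single k 1)) := by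
  simp [projectionMatrix, EuclideanSpace.inner_single_left]

theorem projectionMatrix_mulVec (T : Submodule ℂ (EuclideanSpace ℂ (Fin N)))
    (v : EuclideanSpace ℂ (Fin N)) : projectionMatrix T *ᵥ v = T.starProjection v := by
  ext j
  conv_rhs => rw [← (EuclideanSpace.basisFun (Fin N) ℂ).sum_repr v]
  simp [projectionMatrix, Matrix.mulVec, dotProduct, mul_comm]

theorem isHermitian_projectionMatrix (T : Submodule ℂ (EuclideanSpace ℂ (Fin N))) :
    (projectionMatrix T).IsHermitian := by
  ext j k
  rw [Matrix.conjTranspose_apply, projectionMatrix_apply_eq_inner,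
    projectionMatrix_apply_eq_inner, ← Submodule.inner_starProjection_left_eq_right]
  exact inner_conj_symm _ _

theorem projectionMatrix_mul_self (T : Submodule ℂ (EuclideanSpace ℂ (Fin N))) :
    projectionMatrix T * projectionMatrix T = projectionMatrix T := by
  refine Matrix.ext_of_mulVec_single fun k => ?_
  have h := projectionMatrix_mulVec T (EuclideanSpace.single k 1)
  have h2 := projectionMatrix_mulVec T (T.starProjection (EuclideanSpace.single k 1))
  rw [← Matrix.mulVec_mulVec]
  change projectionMatrix T *ᵥ (projectionMatrix T *ᵥ (EuclideanSpace.single k (1 : ℂ)).ofLp) =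
    projectionMatrix T *ᵥ (EuclideanSpace.single k (1 : ℂ)).ofLp
  rw [h, h2, Submodule.starProjection_eq_self_iff.2 (Submodule.starProjection_apply_mem _ _)]

theorem projectionMatrix_mul_of_mapsTo (T T' : Submodule ℂ (EuclideanSpace ℂ (Fin N)))
    (A : Matrix (Fin N) (Fin N) ℂ) (hA : ∀ v ∈ T, WithLp.toLp 2 (A *ᵥ v) ∈ T') :
    projectionMatrix T' * (A * projectionMatrix T) = A * projectionMatrix T := by
  refine Matrix.ext_of_mulVec_single fun k => ?_
  have h := projectionMatrix_mulVec T (EuclideanSpace.single k 1)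
  have h2 := projectionMatrix_mulVec T'
    (WithLp.toLp 2 (A *ᵥ T.starProjection (EuclideanSpace.single k 1)))
  rw [← Matrix.mulVec_mulVec, ← Matrix.mulVec_mulVec]
  change projectionMatrix T' *ᵥ (A *ᵥ (projectionMatrix T *ᵥ
    (EuclideanSpace.single k (1 : ℂ)).ofLp)) =
    A *ᵥ (projectionMatrix T *ᵥ (EuclideanSpace.single k (1 : ℂ)).ofLp)
  rw [h]
  refine h2.trans ?_
  rw [Submodule.starProjection_eq_self_iff.2 (hA _ (Submodule.starProjection_apply_mem _ _))]

theorem mapsTo_of_commute_projectionMatrix (T : Submodule ℂ (EuclideanSpace ℂ (Fin N)))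
    {R : Matrix (Fin N) (Fin N) ℂ} (hR : Commute R (projectionMatrix T))
    {v : EuclideanSpace ℂ (Fin N)} (hv : v ∈ T) : WithLp.toLp 2 (R *ᵥ v) ∈ T := by
  rw [← Submodule.starProjection_eq_self_iff]
  have h := projectionMatrix_mulVec T (WithLp.toLp 2 (R *ᵥ v))
  apply WithLp.ofLp_injective
  rw [← h]
  change projectionMatrix T *ᵥ (R *ᵥ v.ofLp) = R *ᵥ v.ofLp
  rw [Matrix.mulVec_mulVec, ← hR.eq, ← Matrix.mulVec_mulVec, projectionMatrix_mulVec,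
    Submodule.starProjection_eq_self_iff.2 hv]

end ProjectionMatrix

/-! ### The induced metric and fibre endomorphisms in terms of `i_s x` -/

section InducedMetric

open Matrix

variable {n r N : ℕ} {M : Type*} [TopologicalSpace M] [ChartedSpace (EuclideanSpace ℂ (Fin n)) M]
  {E : M → Type*} [TopologicalSpace (TotalSpace (EuclideanSpace ℂ (Fin r)) E)]
  [∀ x, AddCommGroup (E x)] [∀ x, Module ℂ (E x)] [∀ x, TopologicalSpace (E x)]
  [FiberBundle (EuclideanSpace ℂ (Fin r)) E] [VectorBundle ℂ (EuclideanSpace ℂ (Fin r)) E]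

variable (n r E) in
/-- The evaluation of holomorphic sections at `x`. -/
def evalSection (x : M) : HolSections n r E →ₗ[ℂ] E x where
  toFun t := t x
  map_add' a b := by simp
  map_smul' c a := by simp

@[simp]
theorem evalSection_apply (x : M) (t : HolSections n r E) : evalSection n r E x t = t x := rfl

/-- Under `E x ≅ (i_s x)*` the section `s j` becomes the `j`-th coordinate functional, whose Riesz
vector is the projection of the `j`-th unit vector. -/
theorem toQuotientFiber_basis_apply (hE : IsVeryAmple n r E)
    (s : Basis (Fin N) ℂ (HolSections n r E)) (x : M) (j : Fin N)
    (t : (kodairaMap hE s x).space) :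
    toQuotientFiber hE s x (s j x) t = (t : EuclideanSpace ℂ (Fin N)) j := by
  obtain ⟨ξ, rfl⟩ := (LinearEquiv.ofInjective (kodairaLin (fun j => s j) x)
      (kodairaLin_injective hE s x)).surjective t
  change Dual.eval ℂ (E x) (s j x) ((LinearEquiv.ofInjective (kodairaLin (fun j => s j) x)
      (kodairaLin_injective hE s x)).symm (LinearEquiv.ofInjective (kodairaLin (fun j => s j) x)
      (kodairaLin_injective hE s x) ξ)) = _
  rw [LinearEquiv.symm_apply_apply]
  rfl

/-- The Gram matrix of the basis `s` for the metric `h_s` at the point `x` is the matrix of the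
orthogonal projection onto the image of `x` under the Kodaira map. -/
theorem inducedMetric_basis (hE : IsVeryAmple n r E) (s : Basis (Fin N) ℂ (HolSections n r E))
    (x : M) (j k : Fin N) :
    inducedMetric hE s x (s j x) (s k x) = projectionMatrix (kodairaMap hE s x).space j k := by
  set T := (kodairaMap hE s x).space with hT
  have hRiesz : ∀ i, (InnerProductSpace.toDual ℂ T).symm
      (toQuotientFiber hE s x (s i x)).toContinuousLinearMap =
      T.orthogonalProjectionOnto (EuclideanSpace.single i (1 : ℂ)) := by
    intro i
    rw [LinearIsometryEquiv.symm_apply_eq]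
    ext t
    rw [InnerProductSpace.toDual_apply_apply, Submodule.inner_orthogonalProjectionOnto_eq_of_mem_right,
      EuclideanSpace.inner_single_left]
    simpa using toQuotientFiber_basis_apply hE s x i t
  rw [inducedMetric, hGr, hRiesz, hRiesz, innerSL_apply_apply,
    Submodule.inner_orthogonalProjectionOnto_eq_of_mem_right, projectionMatrix_apply_eq_inner]
  rfl

/-- A matrix that maps the space `i_s x` of the Kodaira map to itself induces an endomorphism of
the fibre `E x`. -/
theorem exists_fiberEnd_of_mapsTo (hE : IsVeryAmple n r E)
    (s : Basis (Fin N) ℂ (HolSections n r E)) (x : M) {R : Matrix (Fin N) (Fin N) ℂ}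
    (hR : ∀ v ∈ (kodairaMap hE s x).space, WithLp.toLp 2 (R *ᵥ v) ∈ (kodairaMap hE s x).space) :
    ∃ f : E x →ₗ[ℂ] E x, ∀ j, f (s j x) = ∑ k, R j k • s k x := by
  let κ := LinearEquiv.ofInjective (kodairaLin (fun j => s j) x) (kodairaLin_injective hE s x)
  have : FiniteDimensional ℂ (E x) :=
    (Trivialization.linearEquivAt ℂ (trivializationAt (EuclideanSpace ℂ (Fin r)) E x) x
      (FiberBundle.mem_baseSet_trivializationAt' x)).symm.finiteDimensional
  let Rl : (kodairaMap hE s x).space →ₗ[ℂ] (kodairaMap hE s x).space :=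
    (Matrix.toEuclideanLin R).restrict hR
  -- `R` acts on `i_s x`, which is a copy of the dual of `E x`; transposing and using reflexivity
  -- gives the action on `E x` itself.
  let g : Dual ℂ (E x) →ₗ[ℂ] Dual ℂ (E x) := κ.symm.toLinearMap ∘ₗ Rl ∘ₗ κ.toLinearMap
  have hg : ∀ ξ j, g ξ (s j x) = ∑ k, R j k * ξ (s k x) := by
    intro ξ j
    have h1 : κ (g ξ) = Rl (κ ξ) := κ.apply_symm_apply _
    have h2 := congrArg (fun t : (kodairaMap hE s x).space => (t : EuclideanSpace ℂ (Fin N)) j) h1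
    exact h2
  refine ⟨(evalEquiv ℂ (E x)).symm.toLinearMap ∘ₗ g.dualMap ∘ₗ (evalEquiv ℂ (E x)).toLinearMap,
    fun j => ?_⟩
  apply (evalEquiv ℂ (E x)).injective
  ext ξ
  simp [hg]

theorem toLp_mulVec_mem_kodairaMap_space (hE : IsVeryAmple n r E)
    (s s' : Basis (Fin N) ℂ (HolSections n r E)) {A : Matrix (Fin N) (Fin N) ℂ}
    (hA : ∀ j, s' j = ∑ k, A j k • s k) (x : M) :
    ∀ v ∈ (kodairaMap hE s x).space, WithLp.toLp 2 (A *ᵥ v) ∈ (kodairaMap hE s' x).space := by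
  rintro _ ⟨ξ, rfl⟩
  refine ⟨ξ, ?_⟩
  ext j
  change ξ (s' j x) = ∑ k, A j k * ξ (s k x)
  rw [← evalSection_apply, hA]
  simp

end InducedMetric

/-! ### Holomorphy of induced bundle maps -/

section LocalFrame

open Filter Topology

variable {n r N : ℕ} {M : Type*} [TopologicalSpace M] [ChartedSpace (EuclideanSpace ℂ (Fin n)) M]
  {E : M → Type*} [TopologicalSpace (TotalSpace (EuclideanSpace ℂ (Fin r)) E)]
  [∀ x, AddCommGroup (E x)] [∀ x, Module ℂ (E x)] [∀ x, TopologicalSpace (E x)]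
  [FiberBundle (EuclideanSpace ℂ (Fin r)) E] [VectorBundle ℂ (EuclideanSpace ℂ (Fin r)) E]

/-- The endomorphism `f` of `E x` is induced by the endomorphism `L` of `H⁰(M, E)`. -/
def IsInducedFiberEnd (L : HolSections n r E →ₗ[ℂ] HolSections n r E) (x : M)
    (f : E x →ₗ[ℂ] E x) : Prop :=
  ∀ t : HolSections n r E, f (t x) = L t x

theorem contMDiffAt_section_coord [ContMDiffVectorBundle ω (EuclideanSpace ℂ (Fin r)) E
      𝓘(ℂ, EuclideanSpace ℂ (Fin n))] (t : HolSections n r E) (x₀ : M) :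
    ContMDiffAt 𝓘(ℂ, EuclideanSpace ℂ (Fin n)) 𝓘(ℂ, EuclideanSpace ℂ (Fin r)) ω
      (fun x => (trivializationAt (EuclideanSpace ℂ (Fin r)) E x₀ ⟨x, t x⟩).2) x₀ :=
  (contMDiffAt_section x₀).1 (t.contMDiff x₀)

/-- The linear map with the columns `τ a`. -/
def columnMap (τ : Fin r → EuclideanSpace ℂ (Fin r)) :
    EuclideanSpace ℂ (Fin r) →L[ℂ] EuclideanSpace ℂ (Fin r) :=
  ∑ a, ContinuousLinearMap.smulRightL ℂ _ _ (EuclideanSpace.proj a) (τ a)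

theorem columnMap_apply (τ : Fin r → EuclideanSpace ℂ (Fin r)) (w : EuclideanSpace ℂ (Fin r)) :
    columnMap τ w = ∑ a, w a • τ a := by
  simp [columnMap]

theorem contMDiffAt_columnMap {τ : Fin r → M → EuclideanSpace ℂ (Fin r)} {x₀ : M}
    (hτ : ∀ a, ContMDiffAt 𝓘(ℂ, EuclideanSpace ℂ (Fin n)) 𝓘(ℂ, EuclideanSpace ℂ (Fin r)) ω
      (τ a) x₀) :
    ContMDiffAt 𝓘(ℂ, EuclideanSpace ℂ (Fin n))
      𝓘(ℂ, EuclideanSpace ℂ (Fin r) →L[ℂ] EuclideanSpace ℂ (Fin r)) ω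
      (fun x => columnMap fun a => τ a x) x₀ := by
  unfold columnMap
  refine ContMDiffAt.sum fun a _ => ?_
  exact (ContinuousLinearMap.contMDiff _).contMDiffAt.comp x₀ (hτ a)

variable [ContMDiffVectorBundle ω (EuclideanSpace ℂ (Fin r)) E 𝓘(ℂ, EuclideanSpace ℂ (Fin n))]

/-- Near each point, the fibre endomorphisms induced by `L` are given, in a local
trivialization, by a holomorphic matrix function. -/
theorem exists_holomorphic_localRepresentation (hE : IsVeryAmple n r E)
    (L : HolSections n r E →ₗ[ℂ] HolSections n r E) (x₀ : M) :
    ∃ G : M → EuclideanSpace ℂ (Fin r) →L[ℂ] EuclideanSpace ℂ (Fin r),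
      ContMDiffAt 𝓘(ℂ, EuclideanSpace ℂ (Fin n))
        𝓘(ℂ, EuclideanSpace ℂ (Fin r) →L[ℂ] EuclideanSpace ℂ (Fin r)) ω G x₀ ∧
      ∀ᶠ x in 𝓝 x₀, ∀ f : E x →ₗ[ℂ] E x, IsInducedFiberEnd L x f → ∀ v : E x,
        (trivializationAt (EuclideanSpace ℂ (Fin r)) E x₀ ⟨x, f v⟩).2 =
          G x (trivializationAt (EuclideanSpace ℂ (Fin r)) E x₀ ⟨x, v⟩).2 := by
  set e := trivializationAt (EuclideanSpace ℂ (Fin r)) E x₀ with he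
  have hx₀ : x₀ ∈ e.baseSet := FiberBundle.mem_baseSet_trivializationAt' x₀
  -- Global generation supplies sections `t a` that form a frame at `x₀`, hence near `x₀`. With `B`
  -- and `C` the coordinate matrices of `t a` and `L (t a)`, an induced `f` satisfies `f B = C`,
  -- which forces `G = C B⁻¹`.
  have ht : ∀ a : Fin r, ∃ t : HolSections n r E,
      e.linearEquivAt ℂ x₀ hx₀ (t x₀) = EuclideanSpace.single a 1 := fun a => by
    obtain ⟨t, h⟩ := hE.generated x₀ ((e.linearEquivAt ℂ x₀ hx₀).symm (EuclideanSpace.single a 1))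
    exact ⟨t, by rw [h, LinearEquiv.apply_symm_apply]⟩
  choose t ht using ht
  let B : M → EuclideanSpace ℂ (Fin r) →L[ℂ] EuclideanSpace ℂ (Fin r) :=
    fun x => columnMap fun a => (e ⟨x, t a x⟩).2
  let C : M → EuclideanSpace ℂ (Fin r) →L[ℂ] EuclideanSpace ℂ (Fin r) :=
    fun x => columnMap fun a => (e ⟨x, L (t a) x⟩).2
  have hB : ContMDiffAt 𝓘(ℂ, EuclideanSpace ℂ (Fin n))
        𝓘(ℂ, EuclideanSpace ℂ (Fin r) →L[ℂ] EuclideanSpace ℂ (Fin r)) ω B x₀ :=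
    contMDiffAt_columnMap fun a => contMDiffAt_section_coord (t a) x₀
  have hC : ContMDiffAt 𝓘(ℂ, EuclideanSpace ℂ (Fin n))
        𝓘(ℂ, EuclideanSpace ℂ (Fin r) →L[ℂ] EuclideanSpace ℂ (Fin r)) ω C x₀ :=
    contMDiffAt_columnMap fun a => contMDiffAt_section_coord (L (t a)) x₀
  have hB₀ : B x₀ = 1 := by
    ext1 w
    have h1 : ∀ a, (e ⟨x₀, t a x₀⟩).2 = EuclideanSpace.single a (1 : ℂ) := ht
    simp only [B, columnMap_apply, h1]
    simpa using (EuclideanSpace.basisFun (Fin r) ℂ).sum_repr w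
  have hinv : ContMDiffAt 𝓘(ℂ, EuclideanSpace ℂ (Fin n))
        𝓘(ℂ, EuclideanSpace ℂ (Fin r) →L[ℂ] EuclideanSpace ℂ (Fin r)) ω
        (fun x => Ring.inverse (B x)) x₀ := by
    have h1 := contDiffAt_ringInverse ℂ (n := ω)
      (1 : (EuclideanSpace ℂ (Fin r) →L[ℂ] EuclideanSpace ℂ (Fin r))ˣ)
    rw [Units.val_one, ← hB₀] at h1
    exact h1.contMDiffAt.comp x₀ hB
  refine ⟨fun x => (C x).comp (Ring.inverse (B x)), hC.clm_comp hinv, ?_⟩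
  have hunit : ∀ᶠ x in 𝓝 x₀, IsUnit (B x) := by
    refine hB.continuousAt.eventually_mem (Units.isOpen.mem_nhds ?_)
    rw [hB₀]
    exact isUnit_one
  filter_upwards [hunit, e.open_baseSet.mem_nhds hx₀] with x hxu hxe f hf v
  set ℓ := e.linearEquivAt ℂ x hxe with hℓ
  have hℓ_apply : ∀ w, (e ⟨x, w⟩).2 = ℓ w := fun w => rfl
  set w := Ring.inverse (B x) (ℓ v) with hw
  have hBw : B x w = ℓ v := by
    rw [hw, ← mul_apply_eq_comp, Ring.mul_inverse_cancel _ hxu]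
    rfl
  have hv : v = ∑ a, w a • t a x := by
    apply ℓ.injective
    rw [← hBw, map_sum]
    simp only [B, columnMap_apply, hℓ_apply, map_smul]
  rw [hℓ_apply, hℓ_apply, ContinuousLinearMap.comp_apply, ← hw]
  conv_lhs => rw [hv]
  simp only [C, columnMap_apply, hℓ_apply, map_sum, map_smul, hf (t _)]

theorem contMDiff_of_isInducedFiberEnd (hE : IsVeryAmple n r E)
    (L : HolSections n r E →ₗ[ℂ] HolSections n r E) (f : ∀ x, E x →ₗ[ℂ] E x)
    (hf : ∀ x, IsInducedFiberEnd L x (f x)) :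
    ContMDiff (𝓘(ℂ, EuclideanSpace ℂ (Fin n)).prod 𝓘(ℂ, EuclideanSpace ℂ (Fin r)))
      (𝓘(ℂ, EuclideanSpace ℂ (Fin n)).prod 𝓘(ℂ, EuclideanSpace ℂ (Fin r))) ω
      (fun p : TotalSpace (EuclideanSpace ℂ (Fin r)) E =>
        (⟨p.1, f p.1 p.2⟩ : TotalSpace (EuclideanSpace ℂ (Fin r)) E)) := by
  intro p₀
  obtain ⟨G, hG, hGe⟩ := exists_holomorphic_localRepresentation hE L p₀.1
  have hproj : ContMDiffAt (𝓘(ℂ, EuclideanSpace ℂ (Fin n)).prod 𝓘(ℂ, EuclideanSpace ℂ (Fin r)))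
      𝓘(ℂ, EuclideanSpace ℂ (Fin n)) ω
      (fun p : TotalSpace (EuclideanSpace ℂ (Fin r)) E => p.1) p₀ := contMDiffAt_proj E
  rw [contMDiffAt_totalSpace]
  refine ⟨hproj, ?_⟩
  have hsnd := (contMDiffAt_totalSpace.1 (contMDiffAt_id
    (I := 𝓘(ℂ, EuclideanSpace ℂ (Fin n)).prod 𝓘(ℂ, EuclideanSpace ℂ (Fin r))) (n := ω)
    (x := p₀))).2
  have hGp := hG.comp p₀ hproj
  refine (hGp.clm_apply hsnd).congr_of_eventuallyEq ?_
  filter_upwards [hproj.continuousAt.eventually hGe] with p hp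
  exact hp (f p.1) (hf p.1) p.2

/-- An invertible endomorphism of `H⁰(M, E)` that induces endomorphisms of the fibres of `E`
comes from a holomorphic automorphism of `E`. -/
theorem exists_holBundleAut_of_isInducedFiberEnd (hE : IsVeryAmple n r E)
    (L : HolSections n r E ≃ₗ[ℂ] HolSections n r E)
    (hL : ∀ x, ∃ f : E x →ₗ[ℂ] E x, IsInducedFiberEnd L.toLinearMap x f) :
    ∃ F : HolBundleAut n r E, ∀ (t : HolSections n r E) (x : M), F.onFiber x (t x) = L t x := by
  choose f hf using hL
  have hsurj : ∀ x, Function.Surjective (f x) := fun x v => by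
    obtain ⟨t, rfl⟩ := hE.generated x v
    exact ⟨L.symm t x, by rw [hf x]; simp⟩
  have hfin : ∀ x, FiniteDimensional ℂ (E x) := fun x =>
    (Trivialization.linearEquivAt ℂ (trivializationAt (EuclideanSpace ℂ (Fin r)) E x) x
      (FiberBundle.mem_baseSet_trivializationAt' x)).symm.finiteDimensional
  let F : ∀ x, E x ≃ₗ[ℂ] E x := fun x =>
    LinearEquiv.ofBijective (f x) ⟨LinearMap.injective_iff_surjective.2 (hsurj x), hsurj x⟩
  have hF : ∀ x (t : HolSections n r E), F x (t x) = L t x := fun x t => hf x t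
  -- The fibrewise inverse is induced by `L.symm`, so the same criterion proves it holomorphic.
  refine ⟨⟨F, contMDiff_of_isInducedFiberEnd hE L.toLinearMap (fun x => (F x).toLinearMap) hF,
    contMDiff_of_isInducedFiberEnd hE L.symm.toLinearMap (fun x => (F x).symm.toLinearMap)
      fun x t => ?_⟩, fun t x => hF x t⟩
  change (F x).symm (t x) = L.symm t x
  rw [LinearEquiv.symm_apply_eq, hF, LinearEquiv.apply_symm_apply]

end LocalFrame

/-! ### Continuity of the projections, and descent of matrices to automorphisms of `E` -/

section Descent

open Matrix
open scoped ComplexOrder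

/-- `Sᴴ` annihilates `v - S (Sᴴ S)⁻¹ Sᴴ v`. This closed formula makes the projection depend
continuously on a local frame matrix `S`. -/
theorem projectionMatrix_range_toEuclideanLin {N r : ℕ} (S : Matrix (Fin N) (Fin r) ℂ)
    (hS : Function.Injective S.mulVec) :
    projectionMatrix (LinearMap.range (Matrix.toEuclideanLin S)) = S * (Sᴴ * S)⁻¹ * Sᴴ := by
  have hdet : IsUnit (Sᴴ * S).det :=
    (Matrix.isUnit_iff_isUnit_det _).1 (Matrix.PosDef.conjTranspose_mul_self S hS).isUnit
  refine Matrix.ext_of_mulVec_single fun k => ?_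
  have h := projectionMatrix_mulVec (LinearMap.range (Matrix.toEuclideanLin S))
    (EuclideanSpace.single k 1)
  refine h.trans ?_
  set v : EuclideanSpace ℂ (Fin N) := EuclideanSpace.single k 1 with hv
  change _ = (S * (Sᴴ * S)⁻¹ * Sᴴ) *ᵥ v.ofLp
  have key : (LinearMap.range (Matrix.toEuclideanLin S)).starProjection v =
      WithLp.toLp 2 ((S * (Sᴴ * S)⁻¹ * Sᴴ) *ᵥ v.ofLp) := by
    apply Submodule.eq_starProjection_of_mem_of_inner_eq_zero
    · refine ⟨WithLp.toLp 2 (((Sᴴ * S)⁻¹ * Sᴴ) *ᵥ v.ofLp), ?_⟩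
      rw [Matrix.toLpLin_apply, Matrix.mulVec_mulVec, Matrix.mul_assoc]
    · rintro _ ⟨w, rfl⟩
      rw [← inner_conj_symm, Matrix.toLpLin_apply, EuclideanSpace.inner_eq_star_dotProduct]
      simp only [WithLp.ofLp_sub]
      rw [dotProduct_comm, Matrix.star_mulVec, ← Matrix.dotProduct_mulVec, Matrix.mulVec_sub,
        Matrix.mulVec_mulVec, ← Matrix.mul_assoc, ← Matrix.mul_assoc, Matrix.mul_nonsing_inv _ hdet,
        Matrix.one_mul, sub_self, dotProduct_zero, map_zero]
  rw [key]

theorem continuousAt_nonsing_inv {r : ℕ} (A : Matrix (Fin r) (Fin r) ℂ) (hA : IsUnit A.det) :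
    ContinuousAt (fun B : Matrix (Fin r) (Fin r) ℂ => B⁻¹) A := by
  simp only [Matrix.inv_def, Ring.inverse_eq_inv']
  have h1 : ContinuousAt (fun B : Matrix (Fin r) (Fin r) ℂ => (B.det)⁻¹) A :=
    (continuous_id.matrix_det.continuousAt).inv₀ hA.ne_zero
  exact h1.smul continuous_id.matrix_adjugate.continuousAt

variable {n r N : ℕ} {M : Type*} [TopologicalSpace M] [ChartedSpace (EuclideanSpace ℂ (Fin n)) M]
  {E : M → Type*} [TopologicalSpace (TotalSpace (EuclideanSpace ℂ (Fin r)) E)]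
  [∀ x, AddCommGroup (E x)] [∀ x, Module ℂ (E x)] [∀ x, TopologicalSpace (E x)]
  [FiberBundle (EuclideanSpace ℂ (Fin r)) E] [VectorBundle ℂ (EuclideanSpace ℂ (Fin r)) E]
  [ContMDiffVectorBundle ω (EuclideanSpace ℂ (Fin r)) E 𝓘(ℂ, EuclideanSpace ℂ (Fin n))]

theorem continuous_projectionMatrix_kodairaMap (hE : IsVeryAmple n r E)
    (s : Basis (Fin N) ℂ (HolSections n r E)) :
    Continuous fun x => projectionMatrix (kodairaMap hE s x).space := by
  rw [continuous_iff_continuousAt]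
  intro x₀
  set e := trivializationAt (EuclideanSpace ℂ (Fin r)) E x₀ with he
  have hx₀ : x₀ ∈ e.baseSet := FiberBundle.mem_baseSet_trivializationAt' x₀
  let S : M → Matrix (Fin N) (Fin r) ℂ := fun x => Matrix.of fun j a => (e ⟨x, s j x⟩).2 a
  have hScont : ContinuousAt S x₀ := by
    refine continuousAt_pi.2 fun j => continuousAt_pi.2 fun a => ?_
    exact (EuclideanSpace.proj (𝕜 := ℂ) a).continuous.continuousAt.comp
      (contMDiffAt_section_coord (s j) x₀).continuousAt
  have hrep : ∀ x ∈ e.baseSet, ∃ Λ : (Fin r → ℂ) ≃ₗ[ℂ] Dual ℂ (E x),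
      ∀ w, WithLp.toLp 2 (S x *ᵥ w) = kodairaLin (fun j => s j) x (Λ w) := by
    intro x hx
    let b := (EuclideanSpace.basisFun (Fin r) ℂ).toBasis.map (e.linearEquivAt ℂ x hx).symm
    refine ⟨b.dualBasis.equivFun.symm, fun w => ?_⟩
    ext j
    change ∑ a, (e.linearEquivAt ℂ x hx (s j x)) a * w a = b.dualBasis.equivFun.symm w (s j x)
    simp [Basis.equivFun_symm_apply, b, mul_comm]
  have hinj : ∀ x ∈ e.baseSet, Function.Injective (S x).mulVec := by
    intro x hx
    obtain ⟨Λ, hΛ⟩ := hrep x hx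
    intro w w' h
    apply Λ.injective
    apply kodairaLin_injective hE s x
    rw [← hΛ, ← hΛ]
    exact congrArg (WithLp.toLp 2) h
  have hrange : ∀ x ∈ e.baseSet,
      (kodairaMap hE s x).space = LinearMap.range (Matrix.toEuclideanLin (S x)) := by
    intro x hx
    obtain ⟨Λ, hΛ⟩ := hrep x hx
    ext v
    constructor
    · rintro ⟨ξ, rfl⟩
      refine ⟨WithLp.toLp 2 (Λ.symm ξ), ?_⟩
      rw [Matrix.toLpLin_apply, hΛ, LinearEquiv.apply_symm_apply]
    · rintro ⟨w, rfl⟩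
      exact ⟨Λ w.ofLp, (hΛ _).symm⟩
  have hdet : IsUnit ((S x₀)ᴴ * S x₀).det :=
    (Matrix.isUnit_iff_isUnit_det _).1
      (Matrix.PosDef.conjTranspose_mul_self _ (hinj x₀ hx₀)).isUnit
  have hstar : ContinuousAt (fun x => (S x)ᴴ) x₀ :=
    (continuous_id.matrix_conjTranspose.continuousAt (x := S x₀)).comp hScont
  have hmul : ∀ {a b c : ℕ} {f : M → Matrix (Fin a) (Fin b) ℂ} {g : M → Matrix (Fin b) (Fin c) ℂ},
      ContinuousAt f x₀ → ContinuousAt g x₀ → ContinuousAt (fun x => f x * g x) x₀ := by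
    intro a b c f g hf hg
    exact ContinuousAt.comp (f := fun x => (f x, g x))
      (continuous_fst.matrix_mul continuous_snd).continuousAt (hf.prodMk hg)
  have hcont : ContinuousAt (fun x => S x * ((S x)ᴴ * S x)⁻¹ * (S x)ᴴ) x₀ :=
    hmul (hmul hScont (ContinuousAt.comp (f := fun x => (S x)ᴴ * S x)
      (continuousAt_nonsing_inv _ hdet) (hmul hstar hScont))) hstar
  refine hcont.congr ?_
  filter_upwards [e.open_baseSet.mem_nhds hx₀] with x hx
  rw [hrange x hx, projectionMatrix_range_toEuclideanLin _ (hinj x hx)]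

theorem continuous_trace_projectionMatrix_mul (hE : IsVeryAmple n r E)
    (s : Basis (Fin N) ℂ (HolSections n r E)) (K : Matrix (Fin N) (Fin N) ℂ) :
    Continuous fun x => (projectionMatrix (kodairaMap hE s x).space * K).trace :=
  ((continuous_projectionMatrix_kodairaMap hE s).matrix_mul continuous_const).matrix_trace

theorem exists_holBundleAut_of_commute (hE : IsVeryAmple n r E)
    (s : Basis (Fin N) ℂ (HolSections n r E)) {R : Matrix (Fin N) (Fin N) ℂ} (hR : IsUnit R)
    (hRP : ∀ x, Commute R (projectionMatrix (kodairaMap hE s x).space)) :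
    ∃ F : HolBundleAut n r E, ∀ (j : Fin N) (x : M), F.onFiber x (s j x) = ∑ k, R j k • s k x := by
  -- Transposed because `Matrix.toLin` reads images of basis vectors from columns, while `R` acts on
  -- the tuple `s` by rows.
  have hdet : IsUnit Rᵀ.det := by
    rw [Matrix.det_transpose]
    exact (Matrix.isUnit_iff_isUnit_det R).1 hR
  set L := Matrix.toLinearEquiv s Rᵀ hdet with hL
  have hLs : ∀ j, L (s j) = ∑ k, R j k • s k := fun j => Matrix.toLin_self s s Rᵀ j
  have hLx : ∀ j x, L (s j) x = ∑ k, R j k • s k x := fun j x => by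
    rw [hLs, ← evalSection_apply]
    simp
  obtain ⟨F, hF⟩ := exists_holBundleAut_of_isInducedFiberEnd hE L fun x => by
    obtain ⟨f, hf⟩ := exists_fiberEnd_of_mapsTo hE s x
      fun v hv => mapsTo_of_commute_projectionMatrix _ (hRP x) hv
    refine ⟨f, fun t => ?_⟩
    have : f ∘ₗ evalSection n r E x = evalSection n r E x ∘ₗ L.toLinearMap :=
      s.ext fun j => (hf j).trans (hLx j x).symm
    exact LinearMap.congr_fun this t
  exact ⟨F, fun j x => (hF _ _).trans (hLx j x)⟩

end Descent

/-! ### Balanced bases: integration and the equality case -/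

section Main

open Matrix
open scoped ComplexOrder

variable {n r N : ℕ} {M : Type*} [TopologicalSpace M] [ChartedSpace (EuclideanSpace ℂ (Fin n)) M]
  {E : M → Type*} [TopologicalSpace (TotalSpace (EuclideanSpace ℂ (Fin r)) E)]
  [∀ x, AddCommGroup (E x)] [∀ x, Module ℂ (E x)] [∀ x, TopologicalSpace (E x)]
  [FiberBundle (EuclideanSpace ℂ (Fin r)) E] [VectorBundle ℂ (EuclideanSpace ℂ (Fin r)) E]
  [T2Space M] [CompactSpace M] [MeasurableSpace M]

/-- If the real volume were `0`, the factor `1 / 0 = 0` would make every `L²`-product vanish,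
against the diagonal value `r / N ≠ 0`. Infinite total mass also has real value `0`, so finiteness
of the measure follows too. -/
theorem IsBalancedBasis.kahlerVolume_real_ne_zero {Ω : KahlerForm n M} {hE : IsVeryAmple n r E}
    {s : Basis (Fin N) ℂ (HolSections n r E)} (hs : IsBalancedBasis Ω hE s) (hr : r ≠ 0)
    (hN : N ≠ 0) : (kahlerVolume Ω).real Set.univ ≠ 0 := by
  intro h0
  have h := hs ⟨0, Nat.pos_of_ne_zero hN⟩ ⟨0, Nat.pos_of_ne_zero hN⟩
  rw [l2Product, h0, if_pos rfl] at h
  rw [Complex.ofReal_zero, div_zero, zero_mul] at h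
  exact div_ne_zero (Nat.cast_ne_zero.2 hr) (Nat.cast_ne_zero.2 hN) h.symm

variable [ContMDiffVectorBundle ω (EuclideanSpace ℂ (Fin r)) E 𝓘(ℂ, EuclideanSpace ℂ (Fin n))]

variable [BorelSpace M]

/-- Balance gives `∫ P = V (r/N)·1` entrywise; pair this with the constant matrix `K`. -/
theorem IsBalancedBasis.integral_trace {Ω : KahlerForm n M} {hE : IsVeryAmple n r E}
    {s : Basis (Fin N) ℂ (HolSections n r E)} (hs : IsBalancedBasis Ω hE s)
    [IsFiniteMeasure (kahlerVolume Ω)] (hV : (kahlerVolume Ω).real Set.univ ≠ 0)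
    (K : Matrix (Fin N) (Fin N) ℂ) :
    ∫ x, (projectionMatrix (kodairaMap hE s x).space * K).trace ∂(kahlerVolume Ω) =
      (kahlerVolume Ω).real Set.univ * ((r : ℂ) / N) * K.trace := by
  have hcont : ∀ j k, Continuous fun x => projectionMatrix (kodairaMap hE s x).space j k :=
    fun j k => (continuous_projectionMatrix_kodairaMap hE s).matrix_elem j k
  have hint : ∀ j k, Integrable (fun x => projectionMatrix (kodairaMap hE s x).space j k * K k j)
      (kahlerVolume Ω) := fun j k =>
    ((hcont j k).integrable_of_hasCompactSupport (HasCompactSupport.of_compactSpace _)).mul_const _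
  have hval : ∀ j k, ∫ x, projectionMatrix (kodairaMap hE s x).space j k ∂(kahlerVolume Ω) =
      if j = k then (kahlerVolume Ω).real Set.univ * ((r : ℂ) / N) else 0 := by
    intro j k
    have h := hs j k
    simp only [l2Product, inducedMetric_basis] at h
    have hV' : ((kahlerVolume Ω).real Set.univ : ℂ) ≠ 0 := by exact_mod_cast hV
    rw [one_div, inv_mul_eq_iff_eq_mul₀ hV'] at h
    rw [h]
    split_ifs <;> simp
  simp only [Matrix.trace, Matrix.diag, Matrix.mul_apply]
  rw [integral_finsetSum _ fun j _ => integrable_finsetSum _ fun k _ => hint j k, Finset.mul_sum]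
  refine Finset.sum_congr rfl fun j _ => ?_
  rw [integral_finsetSum _ fun k _ => hint j k]
  simp [integral_mul_const, hval]

theorem commute_projectionMatrix_of_isBalancedBasis
    [IsManifold 𝓘(ℂ, EuclideanSpace ℂ (Fin n)) ω M] {Ω : KahlerForm n M}
    {hE : IsVeryAmple n r E} {s s' : Basis (Fin N) ℂ (HolSections n r E)}
    (hs : IsBalancedBasis Ω hE s) (hs' : IsBalancedBasis Ω hE s') (hr : r ≠ 0) (hN : N ≠ 0)
    {A : Matrix (Fin N) (Fin N) ℂ} (hA : ∀ j, s' j = ∑ k, A j k • s k) (x : M) :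
    Commute (Aᴴ * A) (projectionMatrix (kodairaMap hE s x).space) := by
  have hV := hs.kahlerVolume_real_ne_zero hr hN
  have : IsFiniteMeasure (kahlerVolume Ω) := by
    refine ⟨lt_top_iff_ne_top.2 fun h => hV ?_⟩
    rw [Measure.real, h, ENNReal.toReal_top]
  have := isOpenPosMeasure_kahlerVolume Ω
  set P := fun x => projectionMatrix (kodairaMap hE s x).space with hP
  set Q := fun x => projectionMatrix (kodairaMap hE s' x).space with hQ
  have hPQ : ∀ x, Q x * (A * P x) = A * P x := fun x =>
    projectionMatrix_mul_of_mapsTo _ _ A (toLp_mulVec_mem_kodairaMap_space hE s s' hA x)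
  have htr := fun x => trace_projection_sub_trace_projection (isHermitian_projectionMatrix _)
    (projectionMatrix_mul_self _) (isHermitian_projectionMatrix _) (projectionMatrix_mul_self _)
    (hPQ x)
  set g : M → ℂ := fun x => (Q x * (A * Aᴴ)).trace - (P x * (Aᴴ * A)).trace with hg
  have hc1 := continuous_trace_projectionMatrix_mul hE s' (A * Aᴴ)
  have hc2 := continuous_trace_projectionMatrix_mul hE s (Aᴴ * A)
  have hgc : Continuous g := hc1.sub hc2
  have hgi : Integrable g (kahlerVolume Ω) :=
    hgc.integrable_of_hasCompactSupport (HasCompactSupport.of_compactSpace _)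
  -- Both bases have the same balancing constant, and `tr (A Aᴴ) = tr (Aᴴ A)`.
  have hg0 : ∫ x, g x ∂(kahlerVolume Ω) = 0 := by
    rw [hg, integral_sub
      (hc1.integrable_of_hasCompactSupport (HasCompactSupport.of_compactSpace _))
      (hc2.integrable_of_hasCompactSupport (HasCompactSupport.of_compactSpace _)),
      hs'.integral_trace hV, hs.integral_trace hV, Matrix.trace_mul_comm A, sub_self]
  have hgn : ∀ x, 0 ≤ g x := fun x => by
    rw [hg]
    simp only
    rw [htr x]
    exact (Matrix.posSemidef_conjTranspose_mul_self _).trace_nonneg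
  have hre : ∫ x, (g x).re ∂(kahlerVolume Ω) = 0 := by
    have := integral_re hgi
    simp only [RCLike.re_to_complex] at this
    rw [this, hg0, Complex.zero_re]
  have hre0 : (fun x => (g x).re) = 0 := by
    refine ((Complex.continuous_re.comp hgc).ae_eq_iff_eq (kahlerVolume Ω) continuous_zero).1 ?_
    exact (integral_eq_zero_iff_of_nonneg (fun x => (Complex.le_def.1 (hgn x)).1) hgi.re).1 hre
  have hgx : g x = 0 :=
    Complex.ext (congrFun hre0 x) (Complex.le_def.1 (hgn x)).2.symm
  refine commute_of_mul_one_sub_eq_zero (isHermitian_projectionMatrix _)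
    (isHermitian_projectionMatrix _) (hPQ x) ?_
  rw [← Matrix.trace_conjTranspose_mul_self_eq_zero_iff, ← htr x]
  exact hgx

end Main

end

theorem mainTheorem2 {n r N : ℕ}
    {M : Type*} [TopologicalSpace M] [T2Space M] [CompactSpace M]
    [MeasurableSpace M] [BorelSpace M]
    [ChartedSpace (EuclideanSpace ℂ (Fin n)) M] [IsManifold 𝓘(ℂ, EuclideanSpace ℂ (Fin n)) ω M]
    (Ω : KahlerForm n M)
    {E : M → Type*} [TopologicalSpace (TotalSpace (EuclideanSpace ℂ (Fin r)) E)]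
    [∀ x, AddCommGroup (E x)] [∀ x, Module ℂ (E x)] [∀ x, TopologicalSpace (E x)]
    [FiberBundle (EuclideanSpace ℂ (Fin r)) E] [VectorBundle ℂ (EuclideanSpace ℂ (Fin r)) E]
    [ContMDiffVectorBundle ω (EuclideanSpace ℂ (Fin r)) E 𝓘(ℂ, EuclideanSpace ℂ (Fin n))]
    (hE : IsVeryAmple n r E)
    (s s' : Basis (Fin N) ℂ (HolSections n r E))
    (hs : IsBalancedBasis Ω hE s) (hs' : IsBalancedBasis Ω hE s') :
    ∃ U ∈ Matrix.unitaryGroup (Fin N) ℂ, ∃ F : HolBundleAut n r E,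
      ∀ (j : Fin N) (x : M), s' j x = ∑ k, U j k • F.onFiber x (s k x) := by
  by_cases hN : N = 0
  · subst hN
    exact ⟨1, one_mem _, ⟨fun x => LinearEquiv.refl ℂ (E x), contMDiff_id, contMDiff_id⟩,
      fun j => j.elim0⟩
  -- In rank `0` the balance condition does not force nonzero volume, but all fibres are trivial and
  -- any `U` and `F` will do.
  by_cases hr : r = 0
  · subst hr
    refine ⟨1, one_mem _, ⟨fun x => LinearEquiv.refl ℂ (E x), contMDiff_id, contMDiff_id⟩,
      fun j x => ?_⟩
    have := (Trivialization.linearEquivAt ℂ (trivializationAt (EuclideanSpace ℂ (Fin 0)) E x) x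
      (FiberBundle.mem_baseSet_trivializationAt' x)).toEquiv.subsingleton
    exact Subsingleton.elim _ _
  -- `s.toMatrix s'` has the coordinates of `s' j` in its `j`-th column; the transpose puts them in
  -- rows, giving `s' = A s`.
  let A : Matrix (Fin N) (Fin N) ℂ := (s.toMatrix s').transpose
  have hA : ∀ j, s' j = ∑ k, A j k • s k := fun j => (s.sum_repr (s' j)).symm
  have hAu : IsUnit A := by
    have := s.invertibleToMatrix s'
    exact (Matrix.isUnit_transpose _).2 (isUnit_of_invertible (s.toMatrix s'))
  obtain ⟨R, hRu, hU, hR⟩ := exists_polarDecomposition A hAu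
  obtain ⟨F, hF⟩ := exists_holBundleAut_of_commute hE s hRu fun x =>
    hR _ (commute_projectionMatrix_of_isBalancedBasis hs hs' hr hN hA x)
  refine ⟨A * R⁻¹, hU, F, fun j x => ?_⟩
  have hAR : A * R⁻¹ * R = A := by
    rw [Matrix.mul_assoc, Matrix.nonsing_inv_mul _ ((Matrix.isUnit_iff_isUnit_det R).1 hRu),
      Matrix.mul_one]
  have hsx : s' j x = ∑ k, A j k • s k x := by
    rw [← evalSection_apply, hA]
    simp
  rw [hsx]
  conv_lhs => rw [← hAR]
  simp only [hF, Matrix.mul_apply, Finset.smul_sum, Finset.sum_smul, smul_smul]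
  exact Finset.sum_comm
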